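/- Let $G$ be an infinite, connected, locally finite, vertex-transitive graph with a fixed vertex $o$. Let $p^{n}(o,o)$ be the probability that simple random walk on $G$ started at $o$ is at $o$ at time $n$; the spectral radius of $G$ is $\lim_{n\to\infty} p^{2n}(o,o)^{1/(2n)}$. The girth of $G$ is the length of its shortest cycle ($\infty$ if there is none). Let $c_n$ be the number of self-avoiding walks of length $n$ in $G$ started at $o$, let $c_n(x)$ be the number of those that end at $x$, and put $\mu=\lim_{n\to\infty} c_n^{1/n}$ and $G_z(x)=\sum_{n\ge 0} c_n(x)z^n$ for $0\le z<\mu^{-1}$. **Theorem.** For every real $\rho<1$ there is an integer $L>0$, depending only on $\rho$, such that every infinite, connected, locally finite, vertex-transitive graph $G$ with spectral radius at most $\rho$ and girth at least $L$ satisfies the self-avoiding walk bubble condition $$\lim_{z\uparrow \mu^{-1}}\ \sum_{x\in G} G_z(x)^2<\infty ,$$ and the critical exponent $\gamma$ of the self-avoiding walk exists and equals $1$, that is, $$\gamma=\lim_{n\to\infty}\frac{\log\left(c_n\mu^{-n}\right)}{\log n}+1=1 .$$ -/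

import Mathlib

open Filter Topology
open scoped ENNReal

namespace SAW

universe u

/-- A graph is (vertex-)transitive if its automorphism group acts transitively on the vertices. -/
def IsTransitive {V : Type u} (G : SimpleGraph V) : Prop :=
  ∀ x y : V, ∃ φ : G ≃g G, φ x = y

open Classical in
/-- `srwProb G n x y` is the probability that the simple random walk on `G` started at `x`
is at `y` at time `n`. -/
noncomputable def srwProb {V : Type u} (G : SimpleGraph V) [G.LocallyFinite] : ℕ → V → V → ℝ
  | 0, x, y => if x = y then 1 else 0
  | n + 1, x, y => ∑ w ∈ G.neighborFinset x, (G.degree x : ℝ)⁻¹ * srwProb G n w y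

/-- The spectral radius `lim_n p^{2n}(o, o)^{1/(2n)}` of the simple random walk. The sequence takes
values in `[0, 1]` and its limit always exists (Fekete), so it is equal to the limsup. -/
noncomputable def srwSpectralRadius {V : Type u} (G : SimpleGraph V) [G.LocallyFinite] (o : V) :
    ℝ :=
  limsup (fun n : ℕ => srwProb G (2 * n) o o ^ (1 / (2 * n : ℝ))) atTop

/-- `c_n(x)`: the number of self-avoiding walks of length `n` from `o` to `x`. -/
noncomputable def sawCountTo {V : Type u} (G : SimpleGraph V) (o : V) (n : ℕ) (x : V) : ℕ :=
  {p : G.Walk o x | p.IsPath ∧ p.length = n}.ncard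

/-- `c_n`: the number of self-avoiding walks of length `n` started at `o`. -/
noncomputable def sawCount {V : Type u} (G : SimpleGraph V) (o : V) (n : ℕ) : ℕ :=
  {p : (x : V) × G.Walk o x | p.2.IsPath ∧ p.2.length = n}.ncard

/-- The connective constant `μ = lim_n c_n^{1/n}`. On a transitive graph of degree `d` the sequence
is bounded by `d` and the limit exists (Fekete), so it is equal to the limsup. -/
noncomputable def connectiveConstant {V : Type u} (G : SimpleGraph V) (o : V) : ℝ :=
  limsup (fun n : ℕ => (sawCount G o n : ℝ) ^ (1 / (n : ℝ))) atTop

/-- `G_z(x) = ∑_{n ≥ 0} c_n(x) z^n` for `z ≥ 0`, as an element of `[0, ∞]`. -/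
noncomputable def sawGreen {V : Type u} (G : SimpleGraph V) (o : V) (z : ℝ) (x : V) : ℝ≥0∞ :=
  ∑' n : ℕ, (sawCountTo G o n x : ℝ≥0∞) * ENNReal.ofReal z ^ n

/-- The bubble condition: `lim_{z ↑ 1/μ} ∑_x G_z(x)^2 < ∞`. -/
def BubbleCondition {V : Type u} (G : SimpleGraph V) (o : V) : Prop :=
  ∃ B : ℝ≥0∞, B < ∞ ∧
    Tendsto (fun z : ℝ => ∑' x : V, sawGreen G o z x ^ 2)
      (𝓝[<] (connectiveConstant G o)⁻¹) (𝓝 B)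

/-- The critical exponent `γ = lim_n log (c_n μ^{-n}) / log n + 1` exists and has the given
value. -/
def HasGammaExponent {V : Type u} (G : SimpleGraph V) (o : V) (γ : ℝ) : Prop :=
  Tendsto (fun n : ℕ =>
      Real.log ((sawCount G o n : ℝ) * ((connectiveConstant G o) ^ n)⁻¹) / Real.log n + 1)
    atTop (𝓝 γ)

end SAW

/-! Let the degree be `D + 1`. The plan is to bound the bubble at a point `z = w / D` that lies
beyond `1 / D`, by a constant `K` depending only on `ρ`, and then to use large girth to show that `1
/ μ` does not exceed `z`.

The bubble bound uses only the spectral radius. Self-avoiding walks are non-backtracking, and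
expanding powers of the adjacency operator in non-backtracking counts, with half-line coefficients,
gives `halfLine_nbCount_le`. Since the half-line Green function is at least `(w / D) ^ n`
(`pow_le_halfLineGreen`), the self-avoiding Green function at `w / D` is at most the random walk
Green function at `w`. For `w * ρ < 1` the latter is square summable, with bound `K = bubbleBound ρ
w`. Expanding the square, `K` also bounds the weighted sum of all `loopSum G p q o`.

Loops are then used twice. Prepending a step to a walk fails only by backtracking or by closing a
cycle (`degree_mul_pathSum_le`); large girth leaves only long cycles, whose weight is a small
multiple of `K`, so the counts grow by a factor of at least `D * (1 + w) / (2 * w) > D / w` at every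
step (`pathSum_le_mul_succ`). Hence `1 / μ < z` and the bubble is finite at `1 / μ`. Moreover,
cutting two walks at an intersection gives `c_k * c_m ≤ K * c_(k+m)` (`pathSum_mul_le_const_mul`).
Together with submultiplicativity, Fekete's lemma applied on both sides yields `μ ^ n ≤ c_n ≤ K * μ
^ n` for `n ≠ 0`, so `γ = 1`. -/

namespace SAW

universe u

/-! ### Point masses. -/

section Ind

variable {V : Type u}

open Classical in
/-- The indicator function of a point. -/
noncomputable def ind (a : V) : V → ℝ≥0∞ := fun x => if x = a then 1 else 0

@[simp] lemma ind_self (a : V) : ind a a = 1 := by simp [ind]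

lemma ind_of_ne {a x : V} (h : x ≠ a) : ind a x = 0 := by simp [ind, h]

lemma ind_comm (a b : V) : ind a b = ind b a := by
  by_cases h : a = b
  · rw [h]
  · rw [ind_of_ne h, ind_of_ne (Ne.symm h)]

lemma tsum_ind_mul (a : V) (g : V → ℝ≥0∞) : ∑' x, ind a x * g x = g a := by
  rw [tsum_eq_single a]
  · simp
  · intro b hb; simp [ind_of_ne hb]

lemma tsum_ind_mul' (a : V) (g : V → ℝ≥0∞) : ∑' x, ind x a * g x = g a := by
  simp_rw [ind_comm _ a, tsum_ind_mul]

lemma ind_comp {G : SimpleGraph V} (φ : G ≃g G) (y : V) : ind (φ y) ∘ φ = ind y := by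
  funext x
  by_cases h : x = y
  · simp [h]
  · rw [Function.comp, ind_of_ne h, ind_of_ne (φ.injective.ne h)]

end Ind

/-! ### Recursive counts of self-avoiding walks, and their near-multiplicativity. -/

section PathSum

variable {V : Type u} (G : SimpleGraph V) [G.LocallyFinite]

open Classical in
/-- The sum of `f` over the endpoints of the self-avoiding walks of length `n` that start at `x` and
avoid the set `S`. -/
noncomputable def pathSum (f : V → ℝ≥0∞) : ℕ → Set V → V → ℝ≥0∞
  | 0, S, x => if x ∈ S then 0 else f x
  | n + 1, S, x => if x ∈ S then 0 else
      ∑ y ∈ G.neighborFinset x, pathSum f n (insert x S) y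

variable {G}

lemma pathSum_of_mem {f : V → ℝ≥0∞} {n : ℕ} {S : Set V} {x : V} (h : x ∈ S) :
    pathSum G f n S x = 0 := by
  cases n <;> simp [pathSum, h]

lemma pathSum_zero {f : V → ℝ≥0∞} {S : Set V} {x : V} (h : x ∉ S) :
    pathSum G f 0 S x = f x := by
  simp [pathSum, h]

lemma pathSum_succ {f : V → ℝ≥0∞} {n : ℕ} {S : Set V} {x : V} (h : x ∉ S) :
    pathSum G f (n + 1) S x = ∑ y ∈ G.neighborFinset x, pathSum G f n (insert x S) y := by
  simp [pathSum, h]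

lemma pathSum_anti (f : V → ℝ≥0∞) (n : ℕ) {S T : Set V} (hST : S ⊆ T) (x : V) :
    pathSum G f n T x ≤ pathSum G f n S x := by
  induction n generalizing S T x with
  | zero =>
    by_cases hT : x ∈ T
    · simp [pathSum_of_mem hT]
    · rw [pathSum_zero hT, pathSum_zero fun h => hT (hST h)]
  | succ n ih =>
    by_cases hT : x ∈ T
    · simp [pathSum_of_mem hT]
    · rw [pathSum_succ hT, pathSum_succ fun h => hT (hST h)]
      exact Finset.sum_le_sum fun y _ => ih (Set.insert_subset_insert hST) y

lemma pathSum_lt_top {f : V → ℝ≥0∞} (hf : ∀ x, f x < ∞) (n : ℕ) (S : Set V) (x : V) :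
    pathSum G f n S x < ∞ := by
  induction n generalizing S x with
  | zero => by_cases h : x ∈ S <;> simp [pathSum, h, hf]
  | succ n ih =>
    by_cases h : x ∈ S
    · simp [pathSum_of_mem h]
    · rw [pathSum_succ h]
      exact ENNReal.sum_lt_top.2 fun y _ => ih _ _

lemma tsum_pathSum_ind_mul (f : V → ℝ≥0∞) (n : ℕ) (S : Set V) (x : V) :
    ∑' y, pathSum G (ind y) n S x * f y = pathSum G f n S x := by
  induction n generalizing S x with
  | zero =>
    by_cases h : x ∈ S
    · simp [pathSum_of_mem h]
    · simp only [pathSum_zero h]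
      exact tsum_ind_mul' x f
  | succ n ih =>
    by_cases h : x ∈ S
    · simp [pathSum_of_mem h]
    · simp only [pathSum_succ h, Finset.sum_mul]
      rw [Summable.tsum_finsetSum fun _ _ => ENNReal.summable]
      exact Finset.sum_congr rfl fun y _ => ih _ _

/-- A self-avoiding walk either avoids `a` or is split at its visit to `a`. -/
lemma pathSum_le_split (f : V → ℝ≥0∞) (n : ℕ) (S : Set V) (x a : V) :
    pathSum G f n S x ≤ pathSum G f n (insert a S) x +
      ∑ q ∈ Finset.range (n + 1), pathSum G (ind a) q S x * pathSum G f (n - q) S a := by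
  induction n generalizing S x with
  | zero =>
    by_cases h : x ∈ S
    · simp [pathSum_of_mem h]
    by_cases hxa : x = a
    · subst hxa
      simp [pathSum_zero h]
    · simp [pathSum, hxa, h]
  | succ n ih =>
    by_cases h : x ∈ S
    · simp [pathSum_of_mem h]
    by_cases hxa : x = a
    · subst hxa
      refine le_add_left ?_
      rw [Finset.sum_range_succ']
      refine le_add_left ?_
      simp [pathSum_zero h]
    · have h' : x ∉ insert a S := by simp [hxa, h]
      rw [pathSum_succ h, pathSum_succ h', Finset.sum_range_succ']
      refine le_trans (Finset.sum_le_sum fun y _ => ih (insert x S) y) ?_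
      rw [Finset.sum_add_distrib, Set.insert_comm]
      refine add_le_add le_rfl (le_trans ?_ (le_add_right le_rfl))
      rw [Finset.sum_comm]
      refine Finset.sum_le_sum fun q _ => ?_
      rw [pathSum_succ h, Finset.sum_mul]
      refine Finset.sum_le_sum fun y _ => ?_
      have : n + 1 - (q + 1) = n - q := by omega
      rw [this]
      exact mul_le_mul' le_rfl (pathSum_anti _ _ (Set.subset_insert _ _) _)

lemma pathSum_map (φ : G ≃g G) (f : V → ℝ≥0∞) (n : ℕ) (S : Set V) (x : V) :
    pathSum G f n (φ '' S) (φ x) = pathSum G (f ∘ φ) n S x := by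
  have hmem : ∀ (S : Set V) (x : V), φ x ∈ φ '' S ↔ x ∈ S := fun S x =>
    φ.injective.mem_set_image
  induction n generalizing S x with
  | zero =>
    by_cases h : x ∈ S
    · rw [pathSum_of_mem h, pathSum_of_mem ((hmem S x).2 h)]
    · rw [pathSum_zero h, pathSum_zero (mt (hmem S x).1 h), Function.comp]
  | succ n ih =>
    by_cases h : x ∈ S
    · rw [pathSum_of_mem h, pathSum_of_mem ((hmem S x).2 h)]
    · rw [pathSum_succ h, pathSum_succ (mt (hmem S x).1 h)]
      symm
      refine Finset.sum_bij (fun y _ => φ y) ?_ ?_ ?_ ?_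
      · intro y hy
        simpa [SimpleGraph.Iso.map_adj_iff] using hy
      · intro a _ b _ hab
        exact φ.injective hab
      · intro y hy
        refine ⟨φ.symm y, ?_, by simp⟩
        simp only [SimpleGraph.mem_neighborFinset] at hy ⊢
        rw [← φ.map_adj_iff]
        simpa using hy
      · intro y _
        rw [← ih, Set.image_insert_eq]

lemma pathSum_ind_map (φ : G ≃g G) (n : ℕ) (x y : V) :
    pathSum G (ind (φ y)) n ∅ (φ x) = pathSum G (ind y) n ∅ x := by
  have := pathSum_map φ (ind (φ y)) n ∅ x
  rwa [Set.image_empty, ind_comp] at this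

lemma pathSum_one_eq (hG : IsTransitive G) (n : ℕ) (x y : V) :
    pathSum G 1 n ∅ x = pathSum G 1 n ∅ y := by
  obtain ⟨φ, rfl⟩ := hG y x
  have := pathSum_map φ 1 n ∅ y
  rwa [Set.image_empty] at this

/-- The number of closed walks `a → x → a` consisting of two self-avoiding walks of lengths `p` and
`q`. -/
noncomputable def loopSum (G : SimpleGraph V) [G.LocallyFinite] (p q : ℕ) (a : V) : ℝ≥0∞ :=
  ∑' x, pathSum G (ind x) p ∅ a * pathSum G (ind a) q ∅ x

lemma loopSum_eq (hG : IsTransitive G) (p q : ℕ) (a b : V) : loopSum G p q a = loopSum G p q b := by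
  obtain ⟨φ, rfl⟩ := hG b a
  unfold loopSum
  rw [← φ.toEquiv.tsum_eq]
  refine tsum_congr fun x => ?_
  change pathSum G (ind (φ x)) p ∅ (φ b) * pathSum G (ind (φ b)) q ∅ (φ x) = _
  rw [pathSum_ind_map, pathSum_ind_map]

lemma loopSum_zero_zero (a : V) : loopSum G 0 0 a = 1 := by
  have := tsum_ind_mul' a (fun x => ind a x)
  simpa [loopSum, pathSum_zero] using this

/-- Submultiplicativity of the number of self-avoiding walks. -/
lemma pathSum_add_le (hG : IsTransitive G) (o : V) (k m : ℕ) (S : Set V) (x : V) :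
    pathSum G 1 (k + m) S x ≤ pathSum G 1 k S x * pathSum G 1 m ∅ o := by
  induction k generalizing S x with
  | zero =>
    by_cases h : x ∈ S
    · simp [pathSum_of_mem h]
    · rw [zero_add, pathSum_zero h, pathSum_one_eq hG m o x]
      simpa using pathSum_anti 1 m (Set.empty_subset S) x
  | succ k ih =>
    by_cases h : x ∈ S
    · simp [pathSum_of_mem h]
    · rw [show k + 1 + m = k + m + 1 by ring, pathSum_succ h, pathSum_succ h, Finset.sum_mul]
      exact Finset.sum_le_sum fun y _ => ih _ _

/-- Cut at the first vertex `v` of the first walk that the second walk visits. The initial piece to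
`v`, of length `k - p`, followed by the end of the second walk, of length `m - q`, is self-avoiding;
the two pieces between `v` and `x` form a loop. The forbidden set `S` carries the part of the first
walk already known to be missed, which makes the induction on `k` work. -/
lemma pathSum_mul_le_aux (hG : IsTransitive G) (o : V) (k m : ℕ) (S : Set V) (a : V) :
    ∑' x, pathSum G (ind x) k S a * pathSum G 1 m S x ≤
      ∑ p ∈ Finset.range (k + 1), ∑ q ∈ Finset.range (m + 1),
        loopSum G p q o * pathSum G 1 (k - p + (m - q)) S a := by
  induction k generalizing S a with
  | zero =>
    rw [tsum_pathSum_ind_mul]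
    by_cases h : a ∈ S
    · simp [pathSum_of_mem h]
    rw [pathSum_zero h, zero_add, Finset.sum_range_one, Finset.sum_range_succ']
    refine le_add_left ?_
    simp [loopSum_zero_zero]
  | succ k ih =>
    by_cases h : a ∈ S
    · simp [pathSum_of_mem h]
    rw [Finset.sum_range_succ]
    -- Either the second walk avoids `a`, and `a` joins the forbidden set, or it is cut at `a`,
    -- which is the term `p = k + 1`.
    have h1 : ∀ x, pathSum G (ind x) (k + 1) S a * pathSum G 1 m S x ≤
        (∑ y ∈ G.neighborFinset a, pathSum G (ind x) k (insert a S) y *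
            pathSum G 1 m (insert a S) x) +
          ∑ q ∈ Finset.range (m + 1), pathSum G (ind x) (k + 1) ∅ a * pathSum G (ind a) q ∅ x *
            pathSum G 1 (m - q) S a := by
      intro x
      refine (mul_le_mul' le_rfl (pathSum_le_split 1 m S x a)).trans ?_
      rw [mul_add, Finset.mul_sum]
      refine add_le_add ?_ (Finset.sum_le_sum fun q _ => ?_)
      · rw [pathSum_succ h, Finset.sum_mul]
      · rw [← mul_assoc]
        exact mul_le_mul' (mul_le_mul' (pathSum_anti _ _ (Set.empty_subset _) _)
          (pathSum_anti _ _ (Set.empty_subset _) _)) le_rfl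
    refine (ENNReal.tsum_le_tsum h1).trans ?_
    rw [ENNReal.tsum_add]
    refine add_le_add ?_ ?_
    · rw [Summable.tsum_finsetSum fun _ _ => ENNReal.summable]
      refine (Finset.sum_le_sum fun y _ => ih (insert a S) y).trans ?_
      rw [Finset.sum_comm]
      refine Finset.sum_le_sum fun p hp => ?_
      rw [Finset.sum_comm]
      refine Finset.sum_le_sum fun q _ => ?_
      have hp' : p ≤ k := Nat.lt_succ_iff.1 (Finset.mem_range.1 hp)
      rw [← Finset.mul_sum, ← pathSum_succ h, show k - p + (m - q) + 1 = k + 1 - p + (m - q) by omega]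
    · rw [Summable.tsum_finsetSum fun _ _ => ENNReal.summable]
      refine Finset.sum_le_sum fun q _ => ?_
      rw [ENNReal.tsum_mul_right, loopSum_eq hG _ _ o a, Nat.sub_self, zero_add]
      rfl

/-- The failure of supermultiplicativity of the number of self-avoiding walks is controlled by
loops. -/
lemma pathSum_mul_le (hG : IsTransitive G) (o : V) (k m : ℕ) :
    pathSum G 1 k ∅ o * pathSum G 1 m ∅ o ≤
      ∑ p ∈ Finset.range (k + 1), ∑ q ∈ Finset.range (m + 1),
        loopSum G p q o * pathSum G 1 (k - p + (m - q)) ∅ o := by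
  refine le_trans (le_of_eq ?_) (pathSum_mul_le_aux hG o k m ∅ o)
  simp_rw [pathSum_one_eq hG m _ o]
  rw [ENNReal.tsum_mul_right, ← tsum_pathSum_ind_mul 1 k ∅ o]
  simp

end PathSum

/-! ### Agreement with walk counts, reversal, and girth. -/

section Walks

variable {V : Type u} {G : SimpleGraph V} [G.LocallyFinite]

omit [G.LocallyFinite] in
lemma cons_isPath_avoiding_iff {S : Set V} {x w y : V} (hx : x ∉ S) (n : ℕ) (h : G.Adj x w)
    (p : G.Walk w y) :
    ((SimpleGraph.Walk.cons h p).IsPath ∧ (SimpleGraph.Walk.cons h p).length = n + 1 ∧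
      ∀ v ∈ (SimpleGraph.Walk.cons h p).support, v ∉ S) ↔
      (p.IsPath ∧ p.length = n ∧ ∀ v ∈ p.support, v ∉ insert x S) := by
  simp only [SimpleGraph.Walk.cons_isPath_iff, SimpleGraph.Walk.length_cons,
    SimpleGraph.Walk.support_cons, List.mem_cons, Set.mem_insert_iff, forall_eq_or_imp]
  constructor
  · rintro ⟨⟨h1, h2⟩, h3, h4, h5⟩
    refine ⟨h1, by omega, fun v hv => ?_⟩
    rintro (rfl | h6)
    · exact h2 hv
    · exact h5 v hv h6
  · rintro ⟨h1, h2, h3⟩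
    exact ⟨⟨h1, fun hv => h3 x hv (Or.inl rfl)⟩, by omega, hx,
      fun v hv hS => h3 v hv (Or.inr hS)⟩

-- The bridge to actual walks: the recursion for `pathSum` is the decomposition of a walk into its
-- first step and its tail.
open Classical in
lemma tsum_walk_eq_pathSum (f : V → ℝ≥0∞) (n : ℕ) (S : Set V) (x : V) :
    (∑' p : (y : V) × G.Walk x y,
      if p.2.IsPath ∧ p.2.length = n ∧ ∀ v ∈ p.2.support, v ∉ S then f p.1 else 0) =
      pathSum G f n S x := by
  induction n generalizing S x with
  | zero =>
    rw [tsum_eq_single ⟨x, SimpleGraph.Walk.nil⟩]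
    · by_cases h : x ∈ S
      · simp [pathSum_of_mem h, h]
      · simp [pathSum_zero h, h]
    · rintro ⟨y, p⟩ hp
      rw [if_neg]
      rintro ⟨-, h, -⟩
      cases p with
      | nil => exact hp rfl
      | cons _ _ => simp at h
  | succ n ih =>
    by_cases h : x ∈ S
    · rw [pathSum_of_mem h, ENNReal.tsum_eq_zero]
      rintro ⟨y, p⟩
      rw [if_neg]
      rintro ⟨-, -, h'⟩
      exact h' x p.start_mem_support h
    · let g : ((w : G.neighborSet x) × (y : V) × G.Walk w y) → (y : V) × G.Walk x y :=
        fun q => ⟨q.2.1, SimpleGraph.Walk.cons q.1.2 q.2.2⟩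
      have hg : Function.Injective g := by
        rintro ⟨⟨w, hw⟩, y, p⟩ ⟨⟨w', hw'⟩, y', p'⟩ hpp
        simp only [g, Sigma.mk.injEq] at hpp
        obtain ⟨rfl, h2⟩ := hpp
        rw [heq_eq_eq] at h2
        injection h2 with _ h3 _ h4
        subst h3
        rw [heq_eq_eq] at h4
        rw [h4]
      rw [← hg.tsum_eq, ENNReal.tsum_sigma', tsum_fintype, pathSum_succ h]
      · rw [Finset.sum_subtype (p := fun y => y ∈ G.neighborSet x) (G.neighborFinset x)
          (fun y => by rw [SimpleGraph.mem_neighborFinset, SimpleGraph.mem_neighborSet])]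
        refine Finset.sum_congr rfl ?_
        rintro ⟨w, hw⟩ -
        change _ = pathSum G f n (insert x S) w
        refine (tsum_congr fun p => ?_).trans (ih (insert x S) w)
        have hiff := cons_isPath_avoiding_iff h n hw p.2
        split_ifs with h1 h2 h2
        · rfl
        · exact absurd (hiff.1 h1) h2
        · exact absurd (hiff.2 h2) h1
        · rfl
      · rintro ⟨y, p⟩ hp
        cases p with
        | nil => simp at hp
        | cons hw p => exact ⟨⟨⟨_, hw⟩, _, p⟩, rfl⟩

lemma ncard_eq_of_encard_eq {α : Type*} {s : Set α} {a : ℝ≥0∞}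
    (h : (s.encard : ℝ≥0∞) = a) (ha : a < ∞) : (s.ncard : ℝ≥0∞) = a := by
  have hs : s.Finite := by
    rw [← Set.encard_lt_top_iff]
    by_contra hc
    rw [not_lt, top_le_iff] at hc
    rw [hc] at h
    simp at h
    exact ha.ne h.symm
  rw [← h, ← hs.cast_ncard_eq]
  simp

lemma sawCount_eq (o : V) (n : ℕ) : (sawCount G o n : ℝ≥0∞) = pathSum G 1 n ∅ o := by
  classical
  refine ncard_eq_of_encard_eq ?_ (pathSum_lt_top (by simp) _ _ _)
  rw [← ENNReal.tsum_set_one, tsum_subtype _ (fun _ => (1 : ℝ≥0∞)), ← tsum_walk_eq_pathSum]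
  refine tsum_congr fun p => ?_
  simp [Set.indicator_apply]

lemma sawCountTo_eq (o : V) (n : ℕ) (x : V) :
    (sawCountTo G o n x : ℝ≥0∞) = pathSum G (ind x) n ∅ o := by
  classical
  refine ncard_eq_of_encard_eq ?_ (pathSum_lt_top (fun y => ?_) _ _ _)
  · rw [← ENNReal.tsum_set_one, tsum_subtype _ (fun _ => (1 : ℝ≥0∞)), ← tsum_walk_eq_pathSum,
      ENNReal.tsum_sigma', tsum_eq_single x]
    · refine tsum_congr fun p => ?_
      simp [Set.indicator_apply]
    · intro y hy
      simp [ind_of_ne hy]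
  · by_cases h : y = x
    · simp [h]
    · simp [ind_of_ne h]

/-- Reversal of paths. The recursion treats the two endpoints differently, so the symmetry is read
off from the sets of walks. -/
lemma pathSum_ind_comm (n : ℕ) (x y : V) :
    pathSum G (ind x) n ∅ y = pathSum G (ind y) n ∅ x := by
  rw [← sawCountTo_eq, ← sawCountTo_eq, sawCountTo, sawCountTo, Nat.cast_inj]
  refine Set.ncard_congr (fun p _ => p.reverse) ?_ ?_ ?_
  · rintro p ⟨h1, h2⟩
    exact ⟨h1.reverse, by simpa using h2⟩
  · intro p q _ _ h
    exact SimpleGraph.Walk.reverse_injective h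
  · rintro p ⟨h1, h2⟩
    exact ⟨p.reverse, ⟨h1.reverse, by simpa using h2⟩, by simp⟩

/-- Short paths between the endpoints of an edge are excluded by large girth. -/
lemma pathSum_ind_eq_zero_of_girth {L : ℕ} (hL : (L : ℕ∞) ≤ G.egirth) {n : ℕ} (hn : 2 ≤ n)
    (hnL : n + 1 < L) {x y : V} (hxy : G.Adj x y) : pathSum G (ind y) n ∅ x = 0 := by
  rw [← sawCountTo_eq, sawCountTo, Nat.cast_eq_zero]
  convert Set.ncard_empty (G.Walk x y)
  rw [Set.eq_empty_iff_forall_notMem]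
  rintro p ⟨hp, rfl⟩
  have hc : (SimpleGraph.Walk.cons hxy.symm p).IsCycle := by
    rw [SimpleGraph.Walk.isCycle_iff_isPath_tail_and_le_length]
    refine ⟨by simpa using hp, by simp; omega⟩
  have := SimpleGraph.le_egirth.1 hL _ _ hc
  rw [SimpleGraph.Walk.length_cons, Nat.cast_le] at this
  omega

lemma tsum_pathSum_ind_eq (n : ℕ) (o : V) :
    ∑' x, pathSum G (ind o) n ∅ x = pathSum G 1 n ∅ o := by
  rw [← tsum_pathSum_ind_mul 1 n ∅ o]
  refine tsum_congr fun x => ?_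
  rw [pathSum_ind_comm]
  simp

end Walks

/-! ### Prepending a step to a self-avoiding walk. -/

section Extension

variable {V : Type u} {G : SimpleGraph V} [G.LocallyFinite]

lemma tsum_sum_neighbor_comm (f : V → V → ℝ≥0∞) :
    ∑' x, ∑ y ∈ G.neighborFinset x, f x y = ∑' x, ∑ y ∈ G.neighborFinset x, f y x := by
  classical
  have h : ∀ (x : V) (g : V → ℝ≥0∞), ∑ y ∈ G.neighborFinset x, g y =
      ∑' y, if G.Adj x y then g y else 0 := by
    intro x g
    rw [tsum_eq_sum (s := G.neighborFinset x)]
    · refine Finset.sum_congr rfl fun y hy => ?_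
      rw [if_pos (by simpa using hy)]
    · intro y hy
      rw [if_neg (by simpa using hy)]
  simp_rw [h]
  rw [ENNReal.tsum_comm]
  refine tsum_congr fun x => tsum_congr fun y => ?_
  rw [G.adj_comm]

lemma pathSum_ind_one {x y : V} (h : G.Adj x y) : pathSum G (ind y) 1 ∅ x = 1 := by
  rw [pathSum_succ (by simp), Finset.sum_eq_single y]
  · rw [pathSum_zero (by simpa using h.ne'), ind_self]
  · intro z _ hz
    by_cases hzx : z = x
    · rw [pathSum_of_mem (by simp [hzx])]
    · rw [pathSum_zero (by simpa using hzx), ind_of_ne hz]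
  · intro hy
    exact absurd (by simpa using h) hy

lemma sum_neighbor_mul_pathSum_le_loopSum (n : ℕ) (y : V) :
    ∑ x ∈ G.neighborFinset y, pathSum G (ind y) n ∅ x ≤ loopSum G n 1 y := by
  refine le_trans ?_ (ENNReal.sum_le_tsum (G.neighborFinset y))
  refine Finset.sum_le_sum fun x hx => ?_
  rw [SimpleGraph.mem_neighborFinset] at hx
  rw [pathSum_ind_one hx.symm, mul_one, pathSum_ind_comm]

/-- The three terms are: the walk avoids `y`; its first step is to `y`; it reaches `y` only after `q
+ 2` steps, and the edge `xy` then closes a cycle of length `q + 3`. -/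
lemma pathSum_split_neighbor (o x y : V) (h : G.Adj x y) (n : ℕ) :
    pathSum G (ind o) (n + 1) ∅ x ≤ pathSum G (ind o) (n + 1) {y} x +
      pathSum G (ind o) n {x} y +
      ∑ q ∈ Finset.range n, pathSum G (ind y) (q + 2) ∅ x *
        pathSum G (ind o) (n - (q + 1)) ∅ y := by
  rw [pathSum_succ (S := ∅) (by simp), pathSum_succ (S := {y}) (by simpa using h.ne)]
  refine (Finset.sum_le_sum fun v _ => pathSum_le_split (ind o) n (insert x ∅) v y).trans ?_
  rw [Finset.sum_add_distrib, add_assoc, Set.insert_comm, ← Set.singleton_def]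
  refine add_le_add le_rfl ?_
  rw [Finset.sum_comm, Finset.sum_range_succ', add_comm]
  refine add_le_add ?_ (Finset.sum_le_sum fun q _ => ?_)
  · rw [← Finset.sum_mul, ← Set.singleton_def]
    have := pathSum_ind_one h
    rw [pathSum_succ (by simp), ← Set.singleton_def] at this
    rw [this, one_mul, Nat.sub_zero]
  · rw [← Finset.sum_mul, ← pathSum_succ (by simp)]
    exact mul_le_mul' le_rfl (pathSum_anti _ _ (Set.empty_subset _) _)

/-- Prepending a step to a self-avoiding walk: the extension is self-avoiding, a backtracking, or
closes a long cycle. -/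
lemma degree_mul_pathSum_le (hG : IsTransitive G) (o : V) {d L : ℕ}
    (hd : ∀ x, G.degree x = d) (hL : (L : ℕ∞) ≤ G.egirth) (n : ℕ) :
    d * pathSum G 1 (n + 1) ∅ o ≤ pathSum G 1 (n + 2) ∅ o + pathSum G 1 (n + 1) ∅ o +
      ∑ q ∈ Finset.range n, (if L ≤ q + 3 then loopSum G (q + 2) 1 o else 0) *
        pathSum G 1 (n - (q + 1)) ∅ o := by
  have h0 : d * pathSum G 1 (n + 1) ∅ o =
      ∑' x, ∑ y ∈ G.neighborFinset x, pathSum G (ind o) (n + 1) ∅ x := by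
    simp_rw [Finset.sum_const, SimpleGraph.card_neighborFinset_eq_degree, hd, nsmul_eq_mul]
    rw [ENNReal.tsum_mul_left, tsum_pathSum_ind_eq]
  rw [h0]
  refine (ENNReal.tsum_le_tsum fun x => Finset.sum_le_sum fun y hy =>
    pathSum_split_neighbor o x y (by simpa using hy) n).trans ?_
  simp_rw [Finset.sum_add_distrib]
  rw [ENNReal.tsum_add, ENNReal.tsum_add]
  refine add_le_add (add_le_add ?_ ?_) ?_
  -- Walks from `x` avoiding `y` become, after prepending `y`, the walks of length `n + 2` from `y`.
  · rw [tsum_sum_neighbor_comm, ← tsum_pathSum_ind_eq]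
    refine ENNReal.tsum_le_tsum fun x => ?_
    rw [pathSum_succ (n := n + 1) (by simp), ← Set.singleton_def]
  -- Walks whose first step is to `y` reassemble into all walks of length `n + 1`.
  · rw [← tsum_pathSum_ind_eq]
    refine ENNReal.tsum_le_tsum fun x => ?_
    rw [pathSum_succ (n := n) (S := ∅) (by simp), ← Set.singleton_def]
  · rw [tsum_sum_neighbor_comm]
    have h1 : ∀ y, ∑ x ∈ G.neighborFinset y, ∑ q ∈ Finset.range n,
        pathSum G (ind y) (q + 2) ∅ x * pathSum G (ind o) (n - (q + 1)) ∅ y ≤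
        ∑ q ∈ Finset.range n, (if L ≤ q + 3 then loopSum G (q + 2) 1 o else 0) *
          pathSum G (ind o) (n - (q + 1)) ∅ y := by
      intro y
      rw [Finset.sum_comm]
      refine Finset.sum_le_sum fun q _ => ?_
      rw [← Finset.sum_mul]
      refine mul_le_mul' ?_ le_rfl
      split_ifs with hq
      · rw [loopSum_eq hG _ _ o y]
        exact sum_neighbor_mul_pathSum_le_loopSum _ _
      · rw [Finset.sum_eq_zero]
        intro x hx
        rw [SimpleGraph.mem_neighborFinset] at hx
        exact pathSum_ind_eq_zero_of_girth hL (by omega) (by omega) hx.symm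
    refine (ENNReal.tsum_le_tsum h1).trans ?_
    rw [Summable.tsum_finsetSum fun _ _ => ENNReal.summable]
    refine Finset.sum_le_sum fun q _ => ?_
    rw [ENNReal.tsum_mul_left, tsum_pathSum_ind_eq]

end Extension

/-! ### Non-backtracking walks and the adjacency operator. -/

section NonBacktracking

variable {V : Type u} (G : SimpleGraph V) [G.LocallyFinite] (o : V)

open Classical in
/-- The number of non-backtracking walks of length `n` from `x` to `o` whose first step does not
lead to `u`. -/
noncomputable def nbAvoid : ℕ → V → V → ℕ
  | 0, _, x => if x = o then 1 else 0
  | n + 1, u, x => ∑ y ∈ (G.neighborFinset x).erase u, nbAvoid n x y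

open Classical in
/-- The number of non-backtracking walks of length `n` from `x` to `o`. -/
noncomputable def nbCount : ℕ → V → ℕ
  | 0, x => if x = o then 1 else 0
  | n + 1, x => ∑ y ∈ G.neighborFinset x, nbAvoid G o n x y

variable {G o}

lemma nbCount_succ_eq {u x : V} (h : G.Adj x u) (n : ℕ) :
    nbCount G o (n + 1) x = nbAvoid G o (n + 1) u x + nbAvoid G o n x u := by
  classical
  rw [nbCount, nbAvoid, Finset.sum_erase_add _ _ (by simpa using h)]

lemma pathSum_le_nbAvoid (n : ℕ) {S : Set V} {u : V} (hu : u ∈ S) (x : V) :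
    pathSum G (ind o) n S x ≤ nbAvoid G o n u x := by
  classical
  by_cases h : x ∈ S
  · simp [pathSum_of_mem h]
  induction n generalizing S u x with
  | zero =>
    rw [pathSum_zero h, nbAvoid]
    by_cases hx : x = o
    · simp [hx]
    · simp [ind_of_ne hx]
  | succ n ih =>
    rw [pathSum_succ h, nbAvoid, Nat.cast_sum,
      ← Finset.sum_erase (a := u) _ (pathSum_of_mem (Set.mem_insert_of_mem _ hu))]
    refine Finset.sum_le_sum fun y _ => ?_
    by_cases hy : y ∈ insert x S
    · simp [pathSum_of_mem hy]
    · exact ih (Set.mem_insert _ _) y hy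

lemma pathSum_le_nbCount (n : ℕ) (x : V) : pathSum G (ind o) n ∅ x ≤ nbCount G o n x := by
  cases n with
  | zero =>
    rw [pathSum_zero (by simp), nbCount]
    by_cases hx : x = o
    · simp [hx]
    · simp [ind_of_ne hx]
  | succ n =>
    rw [pathSum_succ (by simp), nbCount, Nat.cast_sum]
    exact Finset.sum_le_sum fun y _ => pathSum_le_nbAvoid n (Set.mem_insert _ _) y

lemma sum_nbCount_zero (x : V) :
    ∑ y ∈ G.neighborFinset x, nbCount G o 0 y = nbCount G o 1 x := rfl

lemma sum_nbCount_succ_eq (n : ℕ) (x : V) :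
    ∑ y ∈ G.neighborFinset x, nbCount G o (n + 1) y =
      nbCount G o (n + 2) x + ∑ y ∈ G.neighborFinset x, nbAvoid G o n y x := by
  rw [nbCount, ← Finset.sum_add_distrib]
  refine Finset.sum_congr rfl fun y hy => ?_
  exact nbCount_succ_eq (by simpa using hy : G.Adj x y).symm n

/-- Prepend the step from `x` to `y`. If this backtracks, what remains is a walk from `x` not
starting towards `y`; for `n ≥ 1` each such walk occurs for `D` choices of `y`. For `n = 0` it
occurs `D + 1` times, hence only an inequality. -/
lemma sum_nbCount_succ_le {D : ℕ} (hd : ∀ x, G.degree x = D + 1) (n : ℕ) (x : V) :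
    nbCount G o (n + 2) x + D * nbCount G o n x ≤
      ∑ y ∈ G.neighborFinset x, nbCount G o (n + 1) y := by
  rw [sum_nbCount_succ_eq]
  refine Nat.add_le_add_left ?_ _
  cases n with
  | zero =>
    simp only [nbAvoid, nbCount, Finset.sum_const, SimpleGraph.card_neighborFinset_eq_degree, hd,
      smul_eq_mul]
    exact Nat.mul_le_mul_right _ (Nat.le_succ D)
  | succ m =>
    have h : ∑ y ∈ G.neighborFinset x, nbAvoid G o (m + 1) y x + nbCount G o (m + 1) x =
        (D + 1) * nbCount G o (m + 1) x := by
      conv_lhs => rw [nbCount, ← Finset.sum_add_distrib]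
      rw [Finset.sum_congr rfl fun y hy =>
        (nbCount_succ_eq (by simpa using hy : G.Adj x y) m).symm]
      simp [hd]
    rw [add_mul, one_mul] at h
    omega

end NonBacktracking

/-! ### The Green function of the weighted half-line. -/

section HalfLine

/-- The number of walks of length `k` from `n` to `0` on the half-line, where a step to the right is
weighted by `D`. This counts walks in the `(D + 1)`-regular tree (up to the degree of the root). -/
def halfLine (D : ℕ) : ℕ → ℕ → ℕ
  | 0, 0 => 1
  | 0, _ + 1 => 0
  | k + 1, 0 => D * halfLine D k 1
  | k + 1, n + 1 => halfLine D k n + D * halfLine D k (n + 2)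

/-- The generating function of `halfLine D · n`. -/
noncomputable def halfLineGreen (D : ℕ) (u : ℝ≥0∞) (n : ℕ) : ℝ≥0∞ :=
  ∑' k, u ^ k * halfLine D k n

lemma halfLineGreen_succ (D : ℕ) (u : ℝ≥0∞) (n : ℕ) :
    halfLineGreen D u (n + 1) =
      u * (halfLineGreen D u n + D * halfLineGreen D u (n + 2)) := by
  unfold halfLineGreen
  rw [tsum_eq_zero_add' ENNReal.summable, ← ENNReal.tsum_mul_left, ← ENNReal.tsum_add,
    ← ENNReal.tsum_mul_left]
  simp only [halfLine, Nat.cast_zero, mul_zero, zero_add]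
  refine tsum_congr fun k => ?_
  push_cast
  ring

lemma one_le_halfLineGreen_zero (D : ℕ) (u : ℝ≥0∞) : 1 ≤ halfLineGreen D u 0 := by
  refine le_trans ?_ (ENNReal.le_tsum 0)
  simp [halfLine]

/-- The decay rate of the half-line Green function is at least any number below the fixed points
of `f ↦ u + u * D * f ^ 2`. -/
lemma mul_halfLineGreen_le (D : ℕ) (u z : ℝ≥0∞) (hz : ∀ f ≤ z, f < u + u * D * f ^ 2) (n : ℕ) :
    z * halfLineGreen D u n ≤ halfLineGreen D u (n + 1) := by
  -- The supremum `s` of the admissible ratios is admissible, and the recursion makes `u + u * D * s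
  -- ^ 2` admissible as well. So `u + u * D * s ^ 2 ≤ s`, which rules out `s ≤ z`. No finiteness of
  -- the Green function is needed.
  set A : Set ℝ≥0∞ := {f | ∀ n, f * halfLineGreen D u n ≤ halfLineGreen D u (n + 1)} with hA
  have h1 : sSup A ∈ A := by
    intro n
    rw [ENNReal.sSup_mul]
    exact iSup₂_le fun f hf => hf n
  have h2 : u + u * D * sSup A ^ 2 ∈ A := by
    intro n
    rw [halfLineGreen_succ, add_mul, mul_add]
    refine add_le_add le_rfl ?_
    calc u * D * sSup A ^ 2 * halfLineGreen D u n
        = u * (D * (sSup A * (sSup A * halfLineGreen D u n))) := by ring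
      _ ≤ u * (D * halfLineGreen D u (n + 2)) := by
          gcongr
          exact (mul_le_mul' le_rfl (h1 n)).trans (h1 (n + 1))
  have h3 : z ≤ sSup A := by
    by_contra hc
    exact absurd (le_sSup h2) (not_le.2 (hz _ (not_le.1 hc).le))
  exact (mul_le_mul' h3 le_rfl).trans (h1 n)

lemma pow_le_halfLineGreen (D : ℕ) (u z : ℝ≥0∞) (hz : ∀ f ≤ z, f < u + u * D * f ^ 2) (n : ℕ) :
    z ^ n ≤ halfLineGreen D u n := by
  induction n with
  | zero => simpa using one_le_halfLineGreen_zero D u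
  | succ n ih =>
    rw [pow_succ']
    exact (mul_le_mul' le_rfl ih).trans (mul_halfLineGreen_le D u z hz n)

/-- For `w = 1` the fixed points are `1 / D` and `1`; raising `w` above `1` lifts the parabola off
the diagonal on all of `[0, w / D]`. -/
lemma lt_of_le_div {D : ℕ} (hD : 1 ≤ D) {w : ℝ} (hw : 1 < w) (f : ℝ≥0∞)
    (hf : f ≤ ENNReal.ofReal (w / D)) :
    f < ENNReal.ofReal (w / (D + 1)) + ENNReal.ofReal (w / (D + 1)) * D * f ^ 2 := by
  have hD' : (1 : ℝ) ≤ D := by exact_mod_cast hD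
  obtain ⟨x, hx, rfl⟩ : ∃ x : ℝ, 0 ≤ x ∧ f = ENNReal.ofReal x :=
    ⟨f.toReal, ENNReal.toReal_nonneg,
      (ENNReal.ofReal_toReal (ne_top_of_le_ne_top ENNReal.ofReal_ne_top hf)).symm⟩
  rw [ENNReal.ofReal_le_ofReal_iff (by positivity)] at hf
  rw [← ENNReal.ofReal_natCast, ← ENNReal.ofReal_pow hx, ← ENNReal.ofReal_mul (by positivity),
    ← ENNReal.ofReal_mul (by positivity), ← ENNReal.ofReal_add (by positivity) (by positivity),
    ENNReal.ofReal_lt_ofReal_iff (by positivity)]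
  rw [le_div_iff₀ (by positivity)] at hf
  have key : x * (D + 1) < w * (1 + D * x ^ 2) := by
    have h : x * D * (D + 1) < w * (D + (x * D) ^ 2) := by
      set s := x * D with hs
      have hs0 : 0 ≤ s := by positivity
      -- For `s ≤ 1` use `(1 - s) * (D - s) ≥ 0`; for `1 < s ≤ w` use `w * D ≥ s * D` and `w * s ^ 2
      -- > s`.
      rcases le_or_gt s 1 with h1 | h1
      · nlinarith [mul_nonneg (sub_nonneg.2 h1) (sub_nonneg.2 (h1.trans hD')), sq_nonneg s]
      · nlinarith [mul_nonneg (sub_nonneg.2 hf) (by linarith : (0 : ℝ) ≤ D),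
          mul_pos (sub_pos.2 hw) (pow_pos (by linarith : 0 < s) 2), sq_nonneg (s - 1)]
    have h' : (x * (D + 1)) * D < (w * (1 + D * x ^ 2)) * D := by nlinarith
    exact lt_of_mul_lt_mul_right h' (by linarith)
  calc x = x * (D + 1) / (D + 1) := by field_simp
    _ < w * (1 + D * x ^ 2) / (D + 1) := by gcongr
    _ = w / (D + 1) + w / (D + 1) * D * x ^ 2 := by ring

end HalfLine

/-! ### Return probabilities and comparison with non-backtracking walks. -/

section RandomWalk

variable {V : Type u} (G : SimpleGraph V) [G.LocallyFinite]

/-- The transition probabilities of simple random walk, with values in `ℝ≥0∞`. -/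
noncomputable def transProb (k : ℕ) (x y : V) : ℝ≥0∞ := ENNReal.ofReal (srwProb G k x y)

variable {G}

lemma srwProb_nonneg (k : ℕ) (x y : V) : 0 ≤ srwProb G k x y := by
  induction k generalizing x with
  | zero => unfold srwProb; split_ifs <;> simp
  | succ k ih => exact Finset.sum_nonneg fun w _ => mul_nonneg (by positivity) (ih w)

lemma transProb_zero (x y : V) : transProb G 0 x y = ind y x := by
  unfold transProb srwProb
  by_cases h : x = y
  · simp [h]
  · simp [h, ind_of_ne h]

variable {d : ℕ}

lemma transProb_succ (hd : ∀ x, G.degree x = d) (hd0 : d ≠ 0) (k : ℕ) (x y : V) :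
    transProb G (k + 1) x y = ∑ w ∈ G.neighborFinset x, (d : ℝ≥0∞)⁻¹ * transProb G k w y := by
  unfold transProb
  rw [srwProb, ENNReal.ofReal_sum_of_nonneg
    fun w _ => mul_nonneg (by positivity) (srwProb_nonneg k w y)]
  refine Finset.sum_congr rfl fun w _ => ?_
  rw [ENNReal.ofReal_mul (by positivity), hd,
    ENNReal.ofReal_inv_of_pos (by positivity), ENNReal.ofReal_natCast]

lemma transProb_add (hd : ∀ x, G.degree x = d) (hd0 : d ≠ 0) (k l : ℕ) (x z : V) :
    transProb G (k + l) x z = ∑' y, transProb G k x y * transProb G l y z := by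
  induction k generalizing x with
  | zero =>
    simp_rw [zero_add, transProb_zero]
    rw [tsum_ind_mul' x (fun y => transProb G l y z)]
  | succ k ih =>
    rw [show k + 1 + l = k + l + 1 by ring, transProb_succ hd hd0]
    simp_rw [ih, transProb_succ hd hd0 k, Finset.sum_mul, mul_assoc]
    rw [Summable.tsum_finsetSum fun _ _ => ENNReal.summable]
    simp_rw [ENNReal.tsum_mul_left]

lemma transProb_one_comm (hd : ∀ x, G.degree x = d) (hd0 : d ≠ 0) (x y : V) :
    transProb G 1 x y = transProb G 1 y x := by
  classical
  have h : ∀ x y, transProb G 1 x y = if G.Adj x y then (d : ℝ≥0∞)⁻¹ else 0 := by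
    intro x y
    rw [transProb_succ hd hd0]
    simp_rw [transProb_zero]
    split_ifs with hxy
    · rw [Finset.sum_eq_single y]
      · simp
      · intro b _ hb; simp [ind_of_ne hb]
      · intro hy; exact absurd (by simpa using hxy) hy
    · refine Finset.sum_eq_zero fun w hw => ?_
      rw [ind_of_ne, mul_zero]
      rintro rfl
      exact hxy (by simpa using hw)
  rw [h, h, G.adj_comm]

lemma transProb_comm (hd : ∀ x, G.degree x = d) (hd0 : d ≠ 0) (k : ℕ) (x y : V) :
    transProb G k x y = transProb G k y x := by
  induction k generalizing x y with
  | zero => rw [transProb_zero, transProb_zero, ind_comm]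
  | succ k ih =>
    rw [transProb_add hd hd0 k 1, add_comm, transProb_add hd hd0 1 k]
    refine tsum_congr fun w => ?_
    rw [ih, transProb_one_comm hd hd0, mul_comm]

/-- By reversibility these are inner products of `p^n(o,·)` and `p^(n+1)(o,·)`, and `a * b ≤ a ^ 2 +
b ^ 2`. -/
lemma transProb_odd_le (hd : ∀ x, G.degree x = d) (hd0 : d ≠ 0) (n : ℕ) (o : V) :
    transProb G (2 * n + 1) o o ≤ transProb G (2 * n) o o + transProb G (2 * n + 2) o o := by
  rw [show 2 * n + 1 = n + (n + 1) by ring, show 2 * n + 2 = n + 1 + (n + 1) by ring,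
    show 2 * n = n + n by ring, transProb_add hd hd0, transProb_add hd hd0,
    transProb_add hd hd0 (n + 1), ← ENNReal.tsum_add]
  refine ENNReal.tsum_le_tsum fun x => ?_
  rw [transProb_comm hd hd0 (n + 1) x o, transProb_comm hd hd0 n x o]
  rcases le_total (transProb G n o x) (transProb G (n + 1) o x) with h | h
  · exact le_add_left (mul_le_mul' h le_rfl)
  · exact le_add_right (mul_le_mul' le_rfl h)

lemma srwProb_add_ge (hd : ∀ x, G.degree x = d) (hd0 : d ≠ 0) (k l : ℕ) (o : V) :
    srwProb G k o o * srwProb G l o o ≤ srwProb G (k + l) o o := by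
  have h : transProb G k o o * transProb G l o o ≤ transProb G (k + l) o o := by
    rw [transProb_add hd hd0]
    exact ENNReal.le_tsum o
  unfold transProb at h
  rw [← ENNReal.ofReal_mul (srwProb_nonneg _ _ _)] at h
  exact (ENNReal.ofReal_le_ofReal_iff (srwProb_nonneg _ _ _)).1 h

lemma srwProb_mul_ge (hd : ∀ x, G.degree x = d) (hd0 : d ≠ 0) (k j : ℕ) (o : V) :
    srwProb G k o o ^ j ≤ srwProb G (k * j) o o := by
  induction j with
  | zero => simp [srwProb]
  | succ j ih =>
    rw [pow_succ, Nat.mul_succ]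
    exact (mul_le_mul_of_nonneg_right ih (srwProb_nonneg _ _ _)).trans
      (srwProb_add_ge hd hd0 _ _ _)

lemma srwProb_le_one (k : ℕ) (x y : V) : srwProb G k x y ≤ 1 := by
  induction k generalizing x with
  | zero => unfold srwProb; split_ifs <;> simp
  | succ k ih =>
    rw [srwProb]
    calc ∑ w ∈ G.neighborFinset x, (G.degree x : ℝ)⁻¹ * srwProb G k w y
        ≤ ∑ w ∈ G.neighborFinset x, (G.degree x : ℝ)⁻¹ * 1 := by
          gcongr with w _
          exact ih w
      _ ≤ 1 := by
          simp only [mul_one, Finset.sum_const, SimpleGraph.card_neighborFinset_eq_degree,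
            nsmul_eq_mul]
          exact mul_inv_le_one

/-- Supermultiplicativity of return probabilities: the root at time `2 * n` is at most the root at
every multiple of it, hence at most the limsup. -/
lemma srwProb_even_le (hd : ∀ x, G.degree x = d) (hd0 : d ≠ 0) (o : V) {ρ : ℝ}
    (hρ : srwSpectralRadius G o ≤ ρ) (n : ℕ) : srwProb G (2 * n) o o ≤ ρ ^ (2 * n) := by
  rcases Nat.eq_zero_or_pos n with rfl | hn
  · simp [srwProb]
  have hb : IsBoundedUnder (· ≤ ·) atTop
      (fun n : ℕ => srwProb G (2 * n) o o ^ (1 / (2 * n : ℝ))) := by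
    refine isBoundedUnder_of ⟨1, fun n => ?_⟩
    exact Real.rpow_le_one (srwProb_nonneg _ _ _) (srwProb_le_one _ _ _) (by positivity)
  have h : srwProb G (2 * n) o o ^ (1 / (2 * n : ℝ)) ≤ srwSpectralRadius G o := by
    refine le_limsup_of_frequently_le ?_ hb
    rw [frequently_atTop]
    intro N
    refine ⟨n * (N + 1), by nlinarith, ?_⟩
    have h1 := srwProb_mul_ge hd hd0 (2 * n) (N + 1) o
    have hn' : (n : ℝ) ≠ 0 := by positivity
    calc srwProb G (2 * n) o o ^ (1 / (2 * n : ℝ))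
        = (srwProb G (2 * n) o o ^ (N + 1)) ^ (1 / (2 * (n * (N + 1) : ℕ) : ℝ)) := by
          rw [← Real.rpow_natCast, ← Real.rpow_mul (srwProb_nonneg _ _ _)]
          congr 1
          push_cast
          field_simp
      _ ≤ _ := by
          rw [← mul_assoc]
          exact Real.rpow_le_rpow (pow_nonneg (srwProb_nonneg _ _ _) _) h1 (by positivity)
  have h2 := h.trans hρ
  calc srwProb G (2 * n) o o = (srwProb G (2 * n) o o ^ (1 / (2 * n : ℝ))) ^ (2 * n) := by
        rw [← Real.rpow_natCast, ← Real.rpow_mul (srwProb_nonneg _ _ _)]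
        push_cast
        rw [one_div_mul_cancel (by positivity), Real.rpow_one]
    _ ≤ ρ ^ (2 * n) := by
        gcongr
        exact Real.rpow_nonneg (srwProb_nonneg _ _ _) _

lemma transProb_le (hd : ∀ x, G.degree x = d) (hd0 : d ≠ 0) (o : V) {ρ : ℝ} (hρ0 : 0 < ρ)
    (hρ1 : ρ ≤ 1) (hρ : srwSpectralRadius G o ≤ ρ) (k : ℕ) :
    transProb G k o o ≤ ENNReal.ofReal (2 / ρ) * ENNReal.ofReal ρ ^ k := by
  have he : ∀ n, transProb G (2 * n) o o ≤ ENNReal.ofReal (ρ ^ (2 * n)) := fun n =>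
    ENNReal.ofReal_le_ofReal (srwProb_even_le hd hd0 o hρ n)
  rw [← ENNReal.ofReal_pow hρ0.le, ← ENNReal.ofReal_mul (by positivity)]
  rcases Nat.even_or_odd' k with ⟨n, rfl | rfl⟩
  · refine (he n).trans (ENNReal.ofReal_le_ofReal ?_)
    refine le_mul_of_one_le_left (by positivity) ?_
    rw [le_div_iff₀ hρ0]
    linarith
  · refine (transProb_odd_le hd hd0 n o).trans ?_
    refine (add_le_add (he n) (he (n + 1))).trans ?_
    rw [← ENNReal.ofReal_add (by positivity) (by positivity)]
    refine ENNReal.ofReal_le_ofReal ?_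
    have h1 : 2 / ρ * ρ ^ (2 * n + 1) = 2 * ρ ^ (2 * n) := by
      rw [pow_succ]; field_simp
    have h2 : ρ ^ (2 * (n + 1)) ≤ ρ ^ (2 * n) := pow_le_pow_of_le_one hρ0.le hρ1 (by omega)
    linarith

/-- The right side counts all walks of length `k`. Applying the adjacency operator to the expansion
in non-backtracking counts transforms its coefficients at least by the half-line recursion, because
of `sum_nbCount_succ_le`. -/
lemma halfLine_nbCount_le {D : ℕ} (hd : ∀ x, G.degree x = D + 1) (o : V) (k : ℕ) (x : V) :
    ∑' n, (halfLine D k n : ℝ≥0∞) * nbCount G o n x ≤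
      ((D + 1 : ℕ) : ℝ≥0∞) ^ k * transProb G k x o := by
  induction k generalizing x with
  | zero =>
    rw [tsum_eq_zero_add' ENNReal.summable]
    simp only [halfLine, Nat.cast_zero, zero_mul, tsum_zero, transProb_zero, nbCount]
    by_cases h : x = o
    · simp [h]
    · simp [h]
  | succ k ih =>
    have h1 : ((D + 1 : ℕ) : ℝ≥0∞) ^ (k + 1) * transProb G (k + 1) x o =
        ∑ y ∈ G.neighborFinset x, ((D + 1 : ℕ) : ℝ≥0∞) ^ k * transProb G k y o := by
      rw [transProb_succ hd (Nat.succ_ne_zero D), Finset.mul_sum]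
      refine Finset.sum_congr rfl fun y _ => ?_
      rw [pow_succ, mul_assoc, ← mul_assoc _ _ (transProb G k y o),
        ENNReal.mul_inv_cancel (by simp) (ENNReal.natCast_ne_top _), one_mul]
    rw [h1]
    refine le_trans ?_ (Finset.sum_le_sum fun y _ => ih y)
    rw [← Summable.tsum_finsetSum fun _ _ => ENNReal.summable]
    simp_rw [← Finset.mul_sum]
    rw [tsum_eq_zero_add' (f := fun n => (halfLine D k n : ℝ≥0∞) * _) ENNReal.summable]
    have h2 : ∀ n, (halfLine D k (n + 1) : ℝ≥0∞) *
        ((nbCount G o (n + 2) x : ℝ≥0∞) + D * nbCount G o n x) ≤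
        (halfLine D k (n + 1) : ℝ≥0∞) *
          ∑ y ∈ G.neighborFinset x, (nbCount G o (n + 1) y : ℝ≥0∞) := by
      intro n
      gcongr
      exact_mod_cast sum_nbCount_succ_le hd n x
    refine le_trans ?_ (add_le_add le_rfl (ENNReal.tsum_le_tsum h2))
    have h3 : ∑ y ∈ G.neighborFinset x, (nbCount G o 0 y : ℝ≥0∞) = nbCount G o 1 x := by
      exact_mod_cast sum_nbCount_zero x
    rw [h3]
    simp_rw [mul_add]
    rw [ENNReal.tsum_add, ← add_assoc,
      ← tsum_eq_zero_add' (f := fun n => (halfLine D k n : ℝ≥0∞) * nbCount G o (n + 1) x)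
        ENNReal.summable, tsum_eq_zero_add' ENNReal.summable]
    rw [tsum_eq_zero_add' (f := fun n => (halfLine D k (n + 1) : ℝ≥0∞) * (D * nbCount G o n x))
        ENNReal.summable]
    simp only [halfLine]
    push_cast
    simp_rw [add_mul]
    rw [ENNReal.tsum_add]
    refine le_of_eq ?_
    simp_rw [mul_assoc, mul_left_comm (D : ℝ≥0∞)]
    ring

end RandomWalk

/-! ### Regularity, and degree at least two. -/

section Degree

variable {V : Type u} {G : SimpleGraph V} [G.LocallyFinite]

lemma pathSum_one_one (x : V) : pathSum G 1 1 ∅ x = G.degree x := by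
  rw [pathSum_succ (by simp), Finset.sum_congr rfl (g := fun _ => (1 : ℝ≥0∞))]
  · simp
  · intro y hy
    have hxy : G.Adj x y := by simpa using hy
    rw [pathSum_zero (by simpa using hxy.ne')]
    rfl

lemma degree_eq_of_isTransitive (hG : IsTransitive G) (x y : V) : G.degree x = G.degree y := by
  have := pathSum_one_eq hG 1 x y
  rw [pathSum_one_one, pathSum_one_one] at this
  exact_mod_cast this

lemma two_le_degree [Infinite V] (hc : G.Connected) {d : ℕ} (hd : ∀ x, G.degree x = d) :
    2 ≤ d := by
  classical
  by_contra! hlt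
  obtain ⟨o⟩ := hc.nonempty
  have hmem : ∀ x (p : G.Walk x o), x ∈ insert o (G.neighborFinset o) := by
    intro x p
    induction p with
    | nil => simp
    | @cons x y o h p ih =>
      rcases Finset.mem_insert.1 ih with rfl | hy
      · exact Finset.mem_insert_of_mem (by simpa using h.symm)
      · have h1 : (G.neighborFinset y).card ≤ 1 := by
          rw [SimpleGraph.card_neighborFinset_eq_degree, hd]; omega
        have := Finset.card_le_one.1 h1 x (by simpa using h.symm) o
          (by simpa [G.adj_comm] using hy)
        simp [this]
  have : (Set.univ : Set V).Finite :=
    (insert o (G.neighborFinset o)).finite_toSet.subset fun x _ => by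
      obtain ⟨p⟩ := hc.preconnected x o
      exact hmem x p
  exact Set.infinite_univ this

end Degree

/-! ### The bubble bound from the spectral radius. -/

section Bubble

/-- An upper bound for the sum of the squares of the Green function of simple random walk, in terms
of a bound `ρ` for the spectral radius. -/
noncomputable def bubbleBound (ρ w : ℝ) : ℝ≥0∞ :=
  ENNReal.ofReal (2 / ρ) * ((1 - ENNReal.ofReal (w * ρ))⁻¹ * (1 - ENNReal.ofReal (w * ρ))⁻¹)

lemma bubbleBound_lt_top {ρ w : ℝ} (h : w * ρ < 1) : bubbleBound ρ w < ∞ := by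
  have h1 : (1 - ENNReal.ofReal (w * ρ))⁻¹ < ∞ := by
    rw [ENNReal.inv_lt_top, tsub_pos_iff_lt, ENNReal.ofReal_lt_one]
    exact h
  exact ENNReal.mul_lt_top ENNReal.ofReal_lt_top (ENNReal.mul_lt_top h1 h1)

variable {V : Type u} {G : SimpleGraph V} [G.LocallyFinite] {D : ℕ}

lemma tsum_pathSum_mul_pow_le (hd : ∀ x, G.degree x = D + 1) (hD : 1 ≤ D) {w : ℝ} (hw : 1 < w)
    (o x : V) :
    ∑' n, pathSum G (ind o) n ∅ x * ENNReal.ofReal (w / D) ^ n ≤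
      ∑' k, ENNReal.ofReal w ^ k * transProb G k x o := by
  have hu : ENNReal.ofReal (w / (D + 1)) * ((D + 1 : ℕ) : ℝ≥0∞) = ENNReal.ofReal w := by
    rw [← ENNReal.ofReal_natCast, ← ENNReal.ofReal_mul (by positivity)]
    congr 1
    push_cast
    field_simp
  set u := ENNReal.ofReal (w / (D + 1)) with hudef
  calc ∑' n, pathSum G (ind o) n ∅ x * ENNReal.ofReal (w / D) ^ n
      ≤ ∑' n, (nbCount G o n x : ℝ≥0∞) * ∑' k, u ^ k * halfLine D k n :=
        ENNReal.tsum_le_tsum fun n => mul_le_mul' (pathSum_le_nbCount n x)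
          (pow_le_halfLineGreen D u _ (lt_of_le_div hD hw) n)
    _ = ∑' k, u ^ k * ∑' n, (halfLine D k n : ℝ≥0∞) * nbCount G o n x := by
        simp_rw [← ENNReal.tsum_mul_left]
        rw [ENNReal.tsum_comm]
        refine tsum_congr fun k => tsum_congr fun n => ?_
        ring
    _ ≤ ∑' k, u ^ k * (((D + 1 : ℕ) : ℝ≥0∞) ^ k * transProb G k x o) :=
        ENNReal.tsum_le_tsum fun k => mul_le_mul' le_rfl (halfLine_nbCount_le hd o k x)
    _ = ∑' k, ENNReal.ofReal w ^ k * transProb G k x o := by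
        refine tsum_congr fun k => ?_
        rw [← mul_assoc, ← mul_pow, hu]

lemma tsum_sq_eq {α : Type*} (f : α → ℝ≥0∞) : (∑' k, f k) ^ 2 = ∑' k, ∑' l, f k * f l := by
  simp_rw [ENNReal.tsum_mul_left, ENNReal.tsum_mul_right, sq]

/-- Chapman-Kolmogorov and symmetry turn the square into a double sum of return probabilities at
times `k + l`, dominated by a product of two geometric series of ratio `w * ρ`. -/
lemma tsum_sq_green_le (hd : ∀ x, G.degree x = D + 1) {ρ w : ℝ} (hρ0 : 0 < ρ) (hρ1 : ρ ≤ 1)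
    (hw : 1 < w) (o : V) (hρ : srwSpectralRadius G o ≤ ρ) :
    ∑' x, (∑' k, ENNReal.ofReal w ^ k * transProb G k x o) ^ 2 ≤ bubbleBound ρ w := by
  have hd0 : D + 1 ≠ 0 := Nat.succ_ne_zero D
  simp_rw [tsum_sq_eq]
  rw [ENNReal.tsum_comm]
  calc ∑' k, ∑' x, ∑' l, ENNReal.ofReal w ^ k * transProb G k x o *
        (ENNReal.ofReal w ^ l * transProb G l x o)
      = ∑' k, ∑' l, ENNReal.ofReal w ^ (k + l) * transProb G (k + l) o o := by
        refine tsum_congr fun k => ?_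
        rw [ENNReal.tsum_comm]
        refine tsum_congr fun l => ?_
        rw [transProb_add hd hd0, ← ENNReal.tsum_mul_left]
        refine tsum_congr fun x => ?_
        rw [transProb_comm hd hd0 k x o]
        ring
    _ ≤ ∑' k, ∑' l, ENNReal.ofReal (2 / ρ) *
          (ENNReal.ofReal (w * ρ) ^ k * ENNReal.ofReal (w * ρ) ^ l) := by
        refine ENNReal.tsum_le_tsum fun k => ENNReal.tsum_le_tsum fun l => ?_
        refine (mul_le_mul' le_rfl (transProb_le hd hd0 o hρ0 hρ1 hρ (k + l))).trans
          (le_of_eq ?_)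
        rw [ENNReal.ofReal_mul (by linarith)]
        ring
    _ = bubbleBound ρ w := by
        simp_rw [ENNReal.tsum_mul_left, ENNReal.tsum_mul_right, ENNReal.tsum_geometric]
        rfl

/-- The bubble bound for self-avoiding walks. -/
lemma tsum_sq_pathSum_le (hd : ∀ x, G.degree x = D + 1) (hD : 1 ≤ D) {ρ w : ℝ} (hρ0 : 0 < ρ)
    (hρ1 : ρ ≤ 1) (hw : 1 < w) (o : V) (hρ : srwSpectralRadius G o ≤ ρ) :
    ∑' x, (∑' n, pathSum G (ind o) n ∅ x * ENNReal.ofReal (w / D) ^ n) ^ 2 ≤ bubbleBound ρ w :=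
  (ENNReal.tsum_le_tsum fun x => pow_le_pow_left' (tsum_pathSum_mul_pow_le hd hD hw o x) 2).trans
    (tsum_sq_green_le hd hρ0 hρ1 hw o hρ)

lemma tsum_loopSum_mul_pow (z : ℝ≥0∞) (o : V) :
    ∑' p, ∑' q, loopSum G p q o * z ^ (p + q) =
      ∑' x, (∑' n, pathSum G (ind o) n ∅ x * z ^ n) ^ 2 := by
  simp_rw [tsum_sq_eq]
  symm
  rw [ENNReal.tsum_comm]
  refine tsum_congr fun p => ?_
  rw [ENNReal.tsum_comm]
  refine tsum_congr fun q => ?_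
  rw [loopSum, ← ENNReal.tsum_mul_right]
  refine tsum_congr fun x => ?_
  rw [pathSum_ind_comm p x o]
  ring

end Bubble

/-! ### Step-by-step growth and supermultiplicativity up to a constant. -/

section Growth

variable {V : Type u} {G : SimpleGraph V} [G.LocallyFinite] {D : ℕ}

lemma pathSum_le_pow_mul {b : ℝ≥0∞} {o : V} {N : ℕ}
    (h : ∀ n < N, pathSum G 1 n ∅ o ≤ b * pathSum G 1 (n + 1) ∅ o) (m j : ℕ) (hmj : m + j ≤ N) :
    pathSum G 1 m ∅ o ≤ b ^ j * pathSum G 1 (m + j) ∅ o := by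
  induction j with
  | zero => simp
  | succ j ih =>
    refine (ih (by omega)).trans ?_
    rw [pow_succ, mul_assoc, ← add_assoc]
    exact mul_le_mul' le_rfl (h _ (by omega))

/-- If the long loops have small total weight then the number of self-avoiding walks grows at least
like `b ^ (-n)`. -/
lemma pathSum_le_mul_succ (hG : IsTransitive G) (hd : ∀ x, G.degree x = D + 1) (hD : 1 ≤ D)
    {w : ℝ} (hw : 1 < w) {K : ℝ≥0∞} (o : V) {M : ℕ} (hM : ((M + 1 : ℕ) : ℕ∞) ≤ G.egirth)
    (hK : ∑' p, ∑' q, loopSum G p q o * ENNReal.ofReal (w / D) ^ (p + q) ≤ K)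
    (hKM : K * ENNReal.ofReal (2 / (1 + w)) ^ M ≤ ENNReal.ofReal (1 - (1 + w) / (2 * w)))
    (n : ℕ) :
    pathSum G 1 n ∅ o ≤
      ENNReal.ofReal (w / D) * ENNReal.ofReal (2 / (1 + w)) * pathSum G 1 (n + 1) ∅ o := by
  set z := ENNReal.ofReal (w / D) with hz
  set τ := ENNReal.ofReal (2 / (1 + w)) with hτ
  -- Chosen so that `z * τ = 1 / (D * κ)`: growth by `D * κ` beats `1 / z` by the factor `1 / τ >
  -- 1`, and this gain makes long loops negligible.
  set κ := (1 + w) / (2 * w) with hκ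
  have hDpos : (0 : ℝ) < D := by exact_mod_cast hD
  have hκ0 : 0 < κ := by positivity
  have hκ1 : κ ≤ 1 := by rw [hκ, div_le_one (by positivity)]; linarith
  have hτ1 : τ ≤ 1 := by
    rw [hτ, ENNReal.ofReal_le_one, div_le_one (by positivity)]; linarith
  have hbκ : z * τ * (D * ENNReal.ofReal κ) = 1 := by
    rw [hz, hτ, ← ENNReal.ofReal_natCast, ← ENNReal.ofReal_mul (by positivity),
      ← ENNReal.ofReal_mul (by positivity), ← ENNReal.ofReal_mul (by positivity),
      ← ENNReal.ofReal_one]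
    congr 1
    rw [hκ]
    field_simp
  have hDz : 1 ≤ D * z := by
    rw [hz, ← ENNReal.ofReal_natCast, ← ENNReal.ofReal_mul (by positivity),
      ENNReal.one_le_ofReal]
    rw [mul_div_cancel₀ _ hDpos.ne']
    exact hw.le
  have hsum : (D : ℝ≥0∞) * ENNReal.ofReal κ + D * ENNReal.ofReal (1 - κ) = D := by
    rw [← mul_add, ← ENNReal.ofReal_add hκ0.le (by linarith)]
    simp
  have htop : ∀ n, pathSum G 1 n ∅ o ≠ ∞ := fun n => (pathSum_lt_top (by simp) _ _ _).ne
  have hstep : ∀ n, (D : ℝ≥0∞) * ENNReal.ofReal κ * pathSum G 1 n ∅ o ≤ pathSum G 1 (n + 1) ∅ o →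
      pathSum G 1 n ∅ o ≤ z * τ * pathSum G 1 (n + 1) ∅ o := by
    intro n h
    calc pathSum G 1 n ∅ o = z * τ * (D * ENNReal.ofReal κ * pathSum G 1 n ∅ o) := by
          rw [← mul_assoc, hbκ, one_mul]
      _ ≤ _ := mul_le_mul' le_rfl h
  induction n using Nat.strong_induction_on with
  | _ n ih =>
  refine hstep n ?_
  cases n with
  | zero =>
    rw [pathSum_one_one, hd, pathSum_zero (by simp)]
    calc (D : ℝ≥0∞) * ENNReal.ofReal κ * 1 ≤ D * 1 * 1 := by
          gcongr
          exact ENNReal.ofReal_le_one.2 hκ1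
      _ ≤ _ := by simp
  | succ n =>
    have h1 := degree_mul_pathSum_le hG o hd hM n
    have h2 : ∑ q ∈ Finset.range n, (if M + 1 ≤ q + 3 then loopSum G (q + 2) 1 o else 0) *
        pathSum G 1 (n - (q + 1)) ∅ o ≤
        D * ENNReal.ofReal (1 - κ) * pathSum G 1 (n + 1) ∅ o := by
      calc ∑ q ∈ Finset.range n, (if M + 1 ≤ q + 3 then loopSum G (q + 2) 1 o else 0) *
            pathSum G 1 (n - (q + 1)) ∅ o
          ≤ ∑ q ∈ Finset.range n, D * τ ^ M * pathSum G 1 (n + 1) ∅ o *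
              (loopSum G (q + 2) 1 o * z ^ (q + 2 + 1)) := by
            refine Finset.sum_le_sum fun q hq => ?_
            rw [Finset.mem_range] at hq
            split_ifs with hMq
            · have h3 := pathSum_le_pow_mul ih (n - (q + 1)) (q + 2) (by omega)
              rw [show n - (q + 1) + (q + 2) = n + 1 by omega] at h3
              calc loopSum G (q + 2) 1 o * pathSum G 1 (n - (q + 1)) ∅ o
                  ≤ loopSum G (q + 2) 1 o * ((z * τ) ^ (q + 2) * pathSum G 1 (n + 1) ∅ o) :=
                    mul_le_mul' le_rfl h3
                _ = τ ^ (q + 2) * (1 * pathSum G 1 (n + 1) ∅ o *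
                      (loopSum G (q + 2) 1 o * z ^ (q + 2))) := by
                    rw [mul_pow]; ring
                _ ≤ τ ^ M * (D * z * pathSum G 1 (n + 1) ∅ o *
                      (loopSum G (q + 2) 1 o * z ^ (q + 2))) :=
                    -- Only `q + 2 ≥ M` survives the girth bound. The factor `D * z ≥ 1` supplies
                    -- the power of `z` for the closing edge, so that the sum is part of the bubble.
                    mul_le_mul' (pow_le_pow_right_of_le_one' hτ1 (by omega))
                      (mul_le_mul' (mul_le_mul' hDz le_rfl) le_rfl)
                _ = _ := by rw [pow_succ z (q + 2)]; ring
            · simp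
        _ ≤ D * τ ^ M * pathSum G 1 (n + 1) ∅ o * K := by
            rw [← Finset.mul_sum]
            refine mul_le_mul' le_rfl (le_trans ?_ hK)
            calc ∑ q ∈ Finset.range n, loopSum G (q + 2) 1 o * z ^ (q + 2 + 1)
                ≤ ∑' q, loopSum G (q + 2) 1 o * z ^ (q + 2 + 1) := ENNReal.sum_le_tsum _
              _ ≤ ∑' p, loopSum G p 1 o * z ^ (p + 1) :=
                  ENNReal.tsum_comp_le_tsum_of_injective (add_left_injective 2)
                    (fun p => loopSum G p 1 o * z ^ (p + 1))
              _ ≤ _ := ENNReal.tsum_le_tsum fun p =>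
                  ENNReal.le_tsum (f := fun q => loopSum G p q o * z ^ (p + q)) 1
        _ = D * (K * τ ^ M) * pathSum G 1 (n + 1) ∅ o := by ring
        _ ≤ _ := mul_le_mul' (mul_le_mul' le_rfl hKM) le_rfl
    have h4 : (D : ℝ≥0∞) * ENNReal.ofReal κ * pathSum G 1 (n + 1) ∅ o +
        (D * ENNReal.ofReal (1 - κ) * pathSum G 1 (n + 1) ∅ o + pathSum G 1 (n + 1) ∅ o) ≤
        pathSum G 1 (n + 2) ∅ o +
        (D * ENNReal.ofReal (1 - κ) * pathSum G 1 (n + 1) ∅ o + pathSum G 1 (n + 1) ∅ o) := by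
      calc _ = ((D + 1 : ℕ) : ℝ≥0∞) * pathSum G 1 (n + 1) ∅ o := by
            rw [← add_assoc, ← add_mul, hsum]
            push_cast
            ring
        _ ≤ _ := h1
        _ ≤ pathSum G 1 (n + 2) ∅ o + pathSum G 1 (n + 1) ∅ o +
              D * ENNReal.ofReal (1 - κ) * pathSum G 1 (n + 1) ∅ o := add_le_add le_rfl h2
        _ = _ := by ring
    refine ENNReal.le_of_add_le_add_right ?_ h4
    exact ENNReal.add_ne_top.2 ⟨ENNReal.mul_ne_top
      (ENNReal.mul_ne_top (ENNReal.natCast_ne_top _) ENNReal.ofReal_ne_top) (htop _), htop _⟩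

/-- Supermultiplicativity up to a constant of the number of self-avoiding walks. -/
lemma pathSum_mul_le_const_mul (hG : IsTransitive G) {b z K : ℝ≥0∞} (hbz : b ≤ z) (o : V)
    (hb : ∀ n, pathSum G 1 n ∅ o ≤ b * pathSum G 1 (n + 1) ∅ o)
    (hK : ∑' p, ∑' q, loopSum G p q o * z ^ (p + q) ≤ K) (k m : ℕ) :
    pathSum G 1 k ∅ o * pathSum G 1 m ∅ o ≤ K * pathSum G 1 (k + m) ∅ o := by
  refine (pathSum_mul_le hG o k m).trans ?_
  calc ∑ p ∈ Finset.range (k + 1), ∑ q ∈ Finset.range (m + 1),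
        loopSum G p q o * pathSum G 1 (k - p + (m - q)) ∅ o
      ≤ ∑ p ∈ Finset.range (k + 1), ∑ q ∈ Finset.range (m + 1),
        loopSum G p q o * z ^ (p + q) * pathSum G 1 (k + m) ∅ o := by
        refine Finset.sum_le_sum fun p hp => Finset.sum_le_sum fun q hq => ?_
        rw [Finset.mem_range] at hp hq
        have h := pathSum_le_pow_mul (N := k + m) (fun n _ => hb n) (k - p + (m - q)) (p + q)
          (by omega)
        rw [show k - p + (m - q) + (p + q) = k + m by omega] at h
        rw [mul_assoc]
        exact mul_le_mul' le_rfl (h.trans (mul_le_mul' (pow_le_pow_left' hbz _) le_rfl))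
    _ = (∑ p ∈ Finset.range (k + 1), ∑ q ∈ Finset.range (m + 1),
        loopSum G p q o * z ^ (p + q)) * pathSum G 1 (k + m) ∅ o := by
        simp_rw [Finset.sum_mul]
    _ ≤ K * pathSum G 1 (k + m) ∅ o := by
        refine mul_le_mul' (le_trans ?_ hK) le_rfl
        exact (Finset.sum_le_sum fun p _ => ENNReal.sum_le_tsum _).trans (ENNReal.sum_le_tsum _)

end Growth

/-! ### Two-sided Fekete argument. -/

section Fekete

/-- A submultiplicative sequence that is supermultiplicative up to a constant grows purely
exponentially. -/
lemma pow_le_and_le_mul_pow {c : ℕ → ℝ} (hc : ∀ n, 0 < c n) (hsub : ∀ k m, c (k + m) ≤ c k * c m)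
    {K b : ℝ} (hK : 0 < K) (hsup : ∀ k m, c k * c m ≤ K * c (k + m)) (hb : 0 < b)
    (hgrow : ∀ n, c n ≤ b * c (n + 1)) {μ : ℝ}
    (hμ : μ = limsup (fun n : ℕ => c n ^ (1 / (n : ℝ))) atTop) :
    b⁻¹ ≤ μ ∧ ∀ n ≠ 0, μ ^ n ≤ c n ∧ c n ≤ K * μ ^ n := by
  have hc0 : 1 ≤ c 0 := by
    have := hsub 0 0
    have h0 := hc 0
    rw [add_zero] at this
    exact le_of_mul_le_mul_left (by linarith) h0
  have hlow : ∀ n, (b⁻¹) ^ n ≤ c n := by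
    intro n
    induction n with
    | zero => simpa using hc0
    | succ n ih =>
      rw [pow_succ', inv_mul_le_iff₀ hb]
      exact ih.trans (hgrow n)
  have hu : Subadditive fun n => Real.log (c n) := by
    intro k m
    rw [← Real.log_mul (hc k).ne' (hc m).ne']
    exact Real.log_le_log (hc _) (hsub k m)
  have hv : Subadditive fun n => Real.log K - Real.log (c n) := by
    intro k m
    have := Real.log_le_log (mul_pos (hc k) (hc m)) (hsup k m)
    rw [Real.log_mul (hc k).ne' (hc m).ne', Real.log_mul hK.ne' (hc _).ne'] at this
    dsimp only
    linarith
  have hdiv : ∀ n ≠ 0, Real.log b⁻¹ ≤ Real.log (c n) / n := by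
    intro n hn
    rw [le_div_iff₀ (by positivity), mul_comm, ← Real.log_pow]
    exact Real.log_le_log (by positivity) (hlow n)
  have hbdd : BddBelow (Set.range fun n : ℕ => Real.log (c n) / n) := by
    -- The `0` accounts for the index `n = 0`, where division by zero gives `0`.
    refine ⟨min 0 (Real.log b⁻¹), ?_⟩
    rintro _ ⟨n, rfl⟩
    rcases eq_or_ne n 0 with rfl | hn
    · simp
    · exact (min_le_right _ _).trans (hdiv n hn)
  have hlim := hu.tendsto_lim hbdd
  have hv_lim : Tendsto (fun n : ℕ => (Real.log K - Real.log (c n)) / n) atTop (𝓝 (-hu.lim)) := by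
    have := (tendsto_const_div_atTop_nhds_zero_nat (Real.log K)).sub hlim
    rw [zero_sub] at this
    refine this.congr fun n => ?_
    rw [sub_div]
  have hvb := hv_lim.bddBelow_range
  have hveq : hv.lim = -hu.lim := tendsto_nhds_unique (hv.tendsto_lim hvb) hv_lim
  have hμexp : μ = Real.exp hu.lim := by
    rw [hμ]
    refine Tendsto.limsup_eq ?_
    refine ((Real.continuous_exp.tendsto _).comp hlim).congr fun n => ?_
    rw [Real.rpow_def_of_pos (hc n), Function.comp, mul_one_div]
  have hμpow : ∀ n : ℕ, μ ^ n = Real.exp (n * hu.lim) := fun n => by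
    rw [hμexp, ← Real.exp_nat_mul]
  refine ⟨?_, fun n hn => ⟨?_, ?_⟩⟩
  · rw [hμexp, ← Real.log_le_iff_le_exp (by positivity)]
    refine ge_of_tendsto hlim ?_
    filter_upwards [eventually_ne_atTop 0] with n hn using hdiv n hn
  · have h := hu.lim_le_div hbdd hn
    rw [le_div_iff₀ (by positivity)] at h
    rw [hμpow, ← Real.le_log_iff_exp_le (hc n)]
    linarith
  · have h := hv.lim_le_div hvb hn
    rw [hveq, le_div_iff₀ (by positivity)] at h
    rw [hμpow, ← Real.log_le_log_iff (hc n) (by positivity),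
      Real.log_mul hK.ne' (Real.exp_pos _).ne', Real.log_exp]
    linarith

end Fekete

/-! ### Assembly. -/

section Main

variable {V : Type u} {G : SimpleGraph V} [G.LocallyFinite]

/-- The bubble is monotone in its parameter, so its left limit at `1 / μ` exists and is at most the
value at any `z ≥ 1 / μ`. -/
lemma bubbleCondition_of_le {z : ℝ≥0∞} {K : ℝ≥0∞} (hK : K < ∞) (o : V)
    (hz : ENNReal.ofReal (connectiveConstant G o)⁻¹ ≤ z)
    (h : ∑' x, (∑' n, pathSum G (ind o) n ∅ x * z ^ n) ^ 2 ≤ K) : BubbleCondition G o := by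
  have hmono : Monotone fun z : ℝ => ∑' x : V, sawGreen G o z x ^ 2 := by
    intro a b hab
    refine ENNReal.tsum_le_tsum fun x => pow_le_pow_left' (ENNReal.tsum_le_tsum fun n => ?_) 2
    exact mul_le_mul' le_rfl (pow_le_pow_left' (ENNReal.ofReal_le_ofReal hab) n)
  refine ⟨_, ?_, hmono.tendsto_nhdsLT _⟩
  refine lt_of_le_of_lt (sSup_le ?_) hK
  rintro _ ⟨y, hy, rfl⟩
  refine le_trans (ENNReal.tsum_le_tsum fun x => pow_le_pow_left'
    (ENNReal.tsum_le_tsum fun n => ?_) 2) h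
  rw [sawCountTo_eq, pathSum_ind_comm]
  exact mul_le_mul' le_rfl (pow_le_pow_left'
    ((ENNReal.ofReal_le_ofReal (le_of_lt hy)).trans hz) n)

omit [G.LocallyFinite] in
lemma hasGammaExponent_one_of_le {o : V} {K : ℝ} (hμ : 0 < connectiveConstant G o)
    (h : ∀ n ≠ 0, connectiveConstant G o ^ n ≤ sawCount G o n ∧
      (sawCount G o n : ℝ) ≤ K * connectiveConstant G o ^ n) : HasGammaExponent G o 1 := by
  unfold HasGammaExponent
  have hlog : Tendsto (fun n : ℕ => Real.log n) atTop atTop :=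
    Real.tendsto_log_atTop.comp tendsto_natCast_atTop_atTop
  have hbound : ∀ n : ℕ, n ≠ 0 →
      1 ≤ (sawCount G o n : ℝ) * (connectiveConstant G o ^ n)⁻¹ ∧
      (sawCount G o n : ℝ) * (connectiveConstant G o ^ n)⁻¹ ≤ K := by
    intro n hn
    have hp : 0 < connectiveConstant G o ^ n := pow_pos hμ n
    rw [← div_eq_mul_inv, one_le_div hp, div_le_iff₀ hp]
    exact h n hn
  have h0 : Tendsto (fun n : ℕ => Real.log ((sawCount G o n : ℝ) *
      ((connectiveConstant G o) ^ n)⁻¹) / Real.log n) atTop (𝓝 0) := by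
    refine tendsto_of_tendsto_of_tendsto_of_le_of_le' tendsto_const_nhds
      (hlog.const_div_atTop (Real.log K)) ?_ ?_
    · filter_upwards [eventually_ne_atTop 0] with n hn
      exact div_nonneg (Real.log_nonneg (hbound n hn).1) (Real.log_natCast_nonneg n)
    · filter_upwards [eventually_ne_atTop 0] with n hn
      have := (hbound n hn).1
      exact div_le_div_of_nonneg_right (Real.log_le_log (by linarith) (hbound n hn).2)
        (Real.log_natCast_nonneg n)
  simpa using h0.add_const 1

lemma exists_mul_pow_le {K τ ε : ℝ≥0∞} (hK : K < ∞) (hτ : τ < 1) (hε : 0 < ε) :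
    ∃ M : ℕ, K * τ ^ M ≤ ε := by
  have h := ENNReal.Tendsto.const_mul (a := K)
    (ENNReal.tendsto_pow_atTop_nhds_zero_of_lt_one hτ) (Or.inr hK.ne)
  rw [mul_zero] at h
  exact (h.eventually (ge_mem_nhds hε)).exists

theorem bubbleCondition_and_hasGammaExponent [Infinite V] (o : V) (hconn : G.Connected)
    (hG : IsTransitive G) {ρ w : ℝ} (hρ0 : 0 < ρ) (hρ1 : ρ ≤ 1) (hw : 1 < w) (hwρ : w * ρ < 1)
    (hρ : srwSpectralRadius G o ≤ ρ) {M : ℕ} (hM : ((M + 1 : ℕ) : ℕ∞) ≤ G.egirth)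
    (hKM : bubbleBound ρ w * ENNReal.ofReal (2 / (1 + w)) ^ M ≤
      ENNReal.ofReal (1 - (1 + w) / (2 * w))) :
    BubbleCondition G o ∧ HasGammaExponent G o 1 := by
  obtain ⟨D, hd, hD⟩ : ∃ D : ℕ, (∀ x, G.degree x = D + 1) ∧ 1 ≤ D := by
    have h2 := two_le_degree hconn fun x => degree_eq_of_isTransitive hG x o
    refine ⟨G.degree o - 1, fun x => ?_, by omega⟩
    rw [degree_eq_of_isTransitive hG x o]
    omega
  have hDpos : (0 : ℝ) < D := by exact_mod_cast hD
  have hw0 : 0 < w := by linarith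
  have hKtop := bubbleBound_lt_top hwρ
  have hbub := tsum_sq_pathSum_le hd hD hρ0 hρ1 hw o hρ
  have hloop := hbub
  rw [← tsum_loopSum_mul_pow] at hloop
  have hgrow := pathSum_le_mul_succ hG hd hD hw o hM hloop hKM
  have hbz : ENNReal.ofReal (w / D) * ENNReal.ofReal (2 / (1 + w)) ≤ ENNReal.ofReal (w / D) := by
    refine mul_le_of_le_one_right' ?_
    rw [ENNReal.ofReal_le_one, div_le_one (by positivity)]
    linarith
  have hsup := pathSum_mul_le_const_mul hG hbz o hgrow hloop
  have hsub := pathSum_add_le hG o (S := ∅) (x := o)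
  simp_rw [← sawCount_eq] at hgrow hsup hsub
  rw [← ENNReal.ofReal_mul (by positivity)] at hgrow hbz
  have hb0 : 0 < w / D * (2 / (1 + w)) := by positivity
  set b := w / D * (2 / (1 + w)) with hb
  have hgrow' : ∀ n, (sawCount G o n : ℝ) ≤ b * sawCount G o (n + 1) := by
    intro n
    have := ENNReal.toReal_mono
      (ENNReal.mul_ne_top ENNReal.ofReal_ne_top (ENNReal.natCast_ne_top _)) (hgrow n)
    simpa [ENNReal.toReal_mul, ENNReal.toReal_ofReal hb0.le] using this
  have hsup' : ∀ k m, (sawCount G o k : ℝ) * sawCount G o m ≤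
      (bubbleBound ρ w).toReal * sawCount G o (k + m) := by
    intro k m
    have := ENNReal.toReal_mono
      (ENNReal.mul_ne_top hKtop.ne (ENNReal.natCast_ne_top _)) (hsup k m)
    simpa [ENNReal.toReal_mul] using this
  have hsub' : ∀ k m, (sawCount G o (k + m) : ℝ) ≤ sawCount G o k * sawCount G o m := by
    intro k m
    exact_mod_cast hsub k m
  have hpos : ∀ n, 0 < (sawCount G o n : ℝ) := by
    intro n
    induction n with
    | zero =>
      have h1 : (sawCount G o 0 : ℝ≥0∞) = 1 := by
        rw [sawCount_eq, pathSum_zero (by simp)]; rfl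
      have h2 : sawCount G o 0 = 1 := by exact_mod_cast h1
      simp [h2]
    | succ n ih => exact pos_of_mul_pos_right (ih.trans_le (hgrow' n)) hb0.le
  have hK0 : 0 < (bubbleBound ρ w).toReal :=
    pos_of_mul_pos_left ((mul_pos (hpos 0) (hpos 0)).trans_le (hsup' 0 0)) (hpos _).le
  obtain ⟨h1, h2⟩ := pow_le_and_le_mul_pow hpos hsub' hK0 hsup' hb0 hgrow'
    (μ := connectiveConstant G o) rfl
  have hμ : 0 < connectiveConstant G o := (inv_pos.2 hb0).trans_le h1
  refine ⟨bubbleCondition_of_le hKtop o ?_ hbub, hasGammaExponent_one_of_le hμ h2⟩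
  exact (ENNReal.ofReal_le_ofReal (inv_le_of_inv_le₀ hb0 h1)).trans hbz

end Main

end SAW

theorem theorem4 (ρ : ℝ) (hρ : ρ < 1) :
    ∃ L : ℕ, 0 < L ∧
      ∀ (V : Type*) [Infinite V] (G : SimpleGraph V) [G.LocallyFinite] (o : V),
        G.Connected → SAW.IsTransitive G →
        SAW.srwSpectralRadius G o ≤ ρ → (L : ℕ∞) ≤ G.egirth →
          SAW.BubbleCondition G o ∧ SAW.HasGammaExponent G o 1 := by
  -- The maximum keeps the bound positive, as `2 / r` enters the bubble bound. The choice of `w`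
  -- below satisfies both `1 < w` and `w * r < 1`.
  set r := max ρ (1 / 2) with hr
  have hr0 : 0 < r := lt_of_lt_of_le (by norm_num) (le_max_right _ _)
  have hr1 : r < 1 := max_lt hρ (by norm_num)
  set w := 2 / (1 + r) with hwdef
  have hw : 1 < w := by rw [hwdef, one_lt_div (by positivity)]; linarith
  have hwr : w * r < 1 := by
    rw [hwdef, div_mul_eq_mul_div, div_lt_one (by positivity)]; linarith
  obtain ⟨M, hM⟩ := SAW.exists_mul_pow_le (SAW.bubbleBound_lt_top hwr)
    (τ := ENNReal.ofReal (2 / (1 + w))) (ε := ENNReal.ofReal (1 - (1 + w) / (2 * w)))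
    (by rw [ENNReal.ofReal_lt_one, div_lt_one (by linarith)]; linarith)
    (by rw [ENNReal.ofReal_pos, sub_pos, div_lt_one (by linarith)]; linarith)
  refine ⟨M + 1, Nat.succ_pos M, fun V _ G _ o hconn hG hρG hL => ?_⟩
  exact SAW.bubbleCondition_and_hasGammaExponent o hconn hG hr0 hr1.le hw hwr
    (hρG.trans (le_max_left _ _)) hL hM
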